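/- Let $d\ge 1$, $r>0$, $\lambda>0$, and let $p:\mathbb N_0\to[0,1]$ be a function that is not identically zero. Write $B(x,s)$ for the closed Euclidean ball, $|\cdot|$ for Lebesgue measure, $v_d:=|B(0,1)|$, $\mu:=\lambda v_d r^d$, and \[ \omega_d(t):=\frac{|B(0,1)\cap B(te_1,1)|}{v_d},\qquad t\ge 0 . \] Let $X$ be a homogeneous Poisson point process on $\mathbb R^d$ with intensity $\lambda$, regarded as a random simple locally finite point configuration: counts in disjoint bounded Borel sets are independent, and the count in a bounded Borel set $A$ is $\mathrm{Poisson}(\lambda|A|)$-distributed. For a configuration $\mathbf x$ and $x\in\mathbf x$ let $n_r(x;\mathbf x):=\#\big((\mathbf x\cap B(x,r))\setminus\{x\}\big)$. Let $Y=T_r(X)$ be the thinning of $X$ which, conditionally on $X=\mathbf x$, retains the points $x\in\mathbf x$ independently, each with probability $p(n_r(x;\mathbf x))$ (that is, $x$ is kept iff $U_x\le p(n_r(x;\mathbf x))$, where the marks $U_x$ are i.i.d. uniform on $[0,1]$ and independent of $X$). The pair correlation function of $Y$ is $g_Y(x,y)=\rho^{(2)}_Y(x,y)/(\rho_Y(x)\rho_Y(y))$,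 where $\rho_Y$ is the Lebesgue density of the intensity measure $B\mapsto\mathbb E[\#(Y\cap B)]$ and $\rho^{(2)}_Y$ is the Lebesgue density of the second factorial moment measure $C\mapsto\mathbb E[\#\{(u,v)\in C: u,v\in Y,\ u\ne v\}]$ on $\mathbb R^d\times\mathbb R^d$; it is determined up to Lebesgue-null sets of pairs $(x,y)$. Then these densities exist, and $Y$ has a radial pair correlation function: up to null sets, $g_Y(x,y)=g^\circ_Y(\|x-y\|)$, where for every $h\in\mathbb R^d$, with $t:=\|h\|/r$, \[ g^\circ_Y(\|h\|)=\frac{\mathbb E\big[p\big(U+V_1+\mathbf 1\{\|h\|\le r\}\big)\,p\big(U+V_2+\mathbf 1\{\|h\|\le r\}\big)\big]}{\big(\mathbb E[p(N)]\big)^2}, \] with $U\sim\mathrm{Poisson}(\mu\,\omega_d(t))$ and $V_1,V_2\sim\mathrm{Poisson}(\mu(1-\omega_d(t)))$ independent, and $N\sim\mathrm{Poisson}(\mu)$. In particular, $g^\circ_Y(\|h\|)=1$ whenever $\|h\|>2r$. -/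

import Mathlib

open MeasureTheory ProbabilityTheory
open scoped NNReal ENNReal unitInterval

noncomputable section

namespace NeighbourThinning

/-- `d`-dimensional Euclidean space. -/
abbrev Space (d : ℕ) : Type := EuclideanSpace ℝ (Fin d)

/-- The space of simple locally finite point configurations in `ℝ^d`. -/
structure Config (d : ℕ) where
  points : Set (Space d)
  finite_inter : ∀ B : Set (Space d), Bornology.IsBounded B → (points ∩ B).Finite

namespace Config

variable {d : ℕ}

/-- The number of points of the configuration in `B` (meaningful for bounded `B`, where it is
finite). -/
def count (S : Config d) (B : Set (Space d)) : ℕ := (S.points ∩ B).ncard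

/-- The vague `σ`-algebra: generated by the counts in bounded Borel sets. -/
instance : MeasurableSpace (Config d) :=
  ⨆ (B : Set (Space d)) (_ : MeasurableSet B) (_ : Bornology.IsBounded B),
    MeasurableSpace.comap (fun S : Config d => S.count B) ⊤

/-- The number of neighbours of `x` in the closed ball of radius `r` around `x`. -/
def neighbours (r : ℝ) (x : Space d) (S : Config d) : ℕ :=
  ((S.points ∩ Metric.closedBall x r) \ {x}).ncard

/-- Given a mark `u x ∈ [0,1]` at each point `x` of the configuration, keep exactly the points with
`u x ≤ p (n_r(x; S))`. -/
def retain (r : ℝ) (p : ℕ → I) (S : Config d) (u : S.points → I) : Config d where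
  points := {x | ∃ hx : x ∈ S.points, u ⟨x, hx⟩ ≤ p (S.neighbours r x)}
  finite_inter B hB := (S.finite_inter B hB).subset fun _ hx => ⟨hx.1.1, hx.2⟩

/-- The law of the thinning of the fixed configuration `S`: the points of `S` receive independent
marks that are uniform on `[0,1]`, and `x` is kept iff its mark is at most `p (n_r(x; S))`. -/
def thinnedLaw (r : ℝ) (p : ℕ → I) (S : Config d) : Measure (Config d) :=
  (Measure.infinitePi fun _ : S.points => (volume : Measure I)).map (S.retain r p)

end Config

variable {d : ℕ} {Ω : Type*} [MeasurableSpace Ω]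

/-- `X` is a homogeneous Poisson point process with intensity `lam` on `ℝ^d`. -/
structure IsHomogeneousPoisson (P : Measure Ω) (X : Ω → Config d) (lam : ℝ≥0) : Prop where
  measurable : Measurable X
  indep : ∀ (k : ℕ) (A : Fin k → Set (Space d)), (∀ i, MeasurableSet (A i)) →
    (∀ i, Bornology.IsBounded (A i)) → Pairwise (fun i j => Disjoint (A i) (A j)) →
    iIndepFun (fun i ω => (X ω).count (A i)) P
  law : ∀ A : Set (Space d), MeasurableSet A → Bornology.IsBounded A →
    HasLaw (fun ω => (X ω).count A) (poissonMeasure (lam * (volume A).toNNReal)) P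

/-- `Y` is the neighbour-count dependent thinning `T_r(X)` of `X` with retention rule `p`: it is a
point process whose conditional law given `X = S` is `S.thinnedLaw r p`. -/
structure IsThinning (P : Measure Ω) (r : ℝ) (p : ℕ → I) (X Y : Ω → Config d) : Prop where
  measurable : Measurable Y
  disintegration : ∀ F : Config d × Config d → ℝ≥0∞, Measurable F →
    ∫⁻ ω, F (X ω, Y ω) ∂P = ∫⁻ ω, ∫⁻ S, F (X ω, S) ∂((X ω).thinnedLaw r p) ∂P

/-- `ρ` is a density of the intensity measure `B ↦ E[Y(B)]` with respect to Lebesgue measure. -/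
def IsIntensity (P : Measure Ω) (Y : Ω → Config d) (ρ : Space d → ℝ≥0) : Prop :=
  Measurable ρ ∧ ∀ B : Set (Space d), MeasurableSet B →
    ∫⁻ ω, (((Y ω).points ∩ B).encard : ℝ≥0∞) ∂P = ∫⁻ x in B, (ρ x : ℝ≥0∞)

/-- `ρ₂` is a second-order product density: a Lebesgue density of the second factorial moment
measure `C ↦ E[#{(u, v) ∈ C : u, v ∈ Y, u ≠ v}]`. -/
def IsProductDensity₂ (P : Measure Ω) (Y : Ω → Config d) (ρ₂ : Space d × Space d → ℝ≥0) : Prop :=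
  Measurable ρ₂ ∧ ∀ C : Set (Space d × Space d), MeasurableSet C →
    ∫⁻ ω, (((Y ω).points.offDiag ∩ C).encard : ℝ≥0∞) ∂P =
      ∫⁻ z in C, (ρ₂ z : ℝ≥0∞) ∂((volume : Measure (Space d)).prod volume)

/-- `g` is (a version of) the pair correlation function of `Y`:
`g x y = ρ₂ (x, y) / (ρ x * ρ y)`. -/
def IsPairCorrelation (P : Measure Ω) (Y : Ω → Config d) (g : Space d → Space d → ℝ) : Prop :=
  ∃ (ρ : Space d → ℝ≥0) (ρ₂ : Space d × Space d → ℝ≥0),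
    IsIntensity P Y ρ ∧ IsProductDensity₂ P Y ρ₂ ∧
      ∀ x y, g x y = (ρ₂ (x, y) : ℝ) / ((ρ x : ℝ) * (ρ y : ℝ))

/-- `g` is (a version of) the radial pair correlation function of `Y`. -/
def IsRadialPairCorrelation (P : Measure Ω) (Y : Ω → Config d) (g : ℝ → ℝ) : Prop :=
  IsPairCorrelation P Y fun x y => g ‖x - y‖

/-- The volume `v_d` of the unit ball. -/
def unitBallVolume (d : ℕ) : ℝ := volume.real (Metric.closedBall (0 : Space d) 1)

/-- The normalized overlap volume `ω_d(t) = |B(0,1) ∩ B(t e₁,1)| / v_d`. -/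
def overlap (d : ℕ) [NeZero d] (t : ℝ) : ℝ :=
  volume.real (Metric.closedBall (0 : Space d) 1 ∩
    Metric.closedBall (t • EuclideanSpace.single (0 : Fin d) (1 : ℝ)) 1) / unitBallVolume d

/-- `E[p(U + V₁ + i) p(U + V₂ + i)]` for independent `U ~ Poisson(a)`, `V₁, V₂ ~ Poisson(b)`. -/
def jointRetention (p : ℕ → I) (a b : ℝ≥0) (i : ℕ) : ℝ :=
  ∫ z : ℕ × ℕ × ℕ, (p (z.1 + z.2.1 + i) : ℝ) * (p (z.1 + z.2.2 + i) : ℝ)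
    ∂((poissonMeasure a).prod ((poissonMeasure b).prod (poissonMeasure b)))

/-- `E[p(N)]` for `N ~ Poisson(a)`. -/
def meanRetention (p : ℕ → I) (a : ℝ≥0) : ℝ := ∫ n, (p n : ℝ) ∂(poissonMeasure a)

end NeighbourThinning

end

open NeighbourThinning

noncomputable section

namespace NeighbourThinning

lemma measurable_of_measurable_natCast {α : Type*} [MeasurableSpace α] {f : α → ℕ}
    (hm : Measurable fun a => (f a : ℝ≥0∞)) : Measurable f := by
  refine measurable_to_countable' fun n => ?_
  convert hm (measurableSet_singleton (n : ℝ≥0∞)) using 1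
  ext a
  simp

namespace Config

variable {d : ℕ}

lemma measurable_count {B : Set (Space d)} (hB : MeasurableSet B) (hb : Bornology.IsBounded B) :
    Measurable fun S : Config d => S.count B := by
  rw [measurable_iff_comap_le]
  exact le_iSup_of_le B (le_iSup_of_le hB (le_iSup_of_le hb le_rfl))

lemma measurable_of_count {α : Type*} [MeasurableSpace α] {f : α → Config d}
    (h : ∀ B : Set (Space d), MeasurableSet B → Bornology.IsBounded B →
      Measurable fun a => (f a).count B) : Measurable f := by
  rw [measurable_iff_comap_le]
  simp only [instMeasurableSpace, MeasurableSpace.comap_iSup, iSup_le_iff,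
    MeasurableSpace.comap_comp]
  intro B hB hb
  exact measurable_iff_comap_le.1 (h B hB hb)

lemma countable_points (S : Config d) : S.points.Countable := by
  have : S.points = ⋃ n : ℕ, S.points ∩ Metric.closedBall 0 n := by
    rw [← Set.inter_iUnion, Metric.iUnion_closedBall_nat, Set.inter_univ]
  rw [this]
  exact Set.countable_iUnion fun n => (S.finite_inter _ Metric.isBounded_closedBall).countable

instance (S : Config d) : Countable S.points := S.countable_points.to_subtype

lemma measurableSet_points (S : Config d) : MeasurableSet S.points :=
  S.countable_points.measurableSet

lemma encard_inter (S : Config d) {B : Set (Space d)} (hb : Bornology.IsBounded B) :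
    (S.points ∩ B).encard = S.count B :=
  ((S.finite_inter B hb).cast_ncard_eq).symm

/-- The counting measure on the points of a configuration. -/
def toMeasure (S : Config d) : Measure (Space d) := Measure.count.restrict S.points

lemma toMeasure_apply (S : Config d) {B : Set (Space d)} (hB : MeasurableSet B) :
    S.toMeasure B = ((S.points ∩ B).encard : ℝ≥0∞) := by
  rw [toMeasure, Measure.restrict_apply hB, Measure.count_apply (hB.inter S.measurableSet_points),
    Set.inter_comm]

lemma toMeasure_apply_of_isBounded (S : Config d) {B : Set (Space d)} (hB : MeasurableSet B)
    (hb : Bornology.IsBounded B) : S.toMeasure B = S.count B := by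
  rw [S.toMeasure_apply hB, S.encard_inter hb]; rfl

lemma lintegral_toMeasure (S : Config d) (f : Space d → ℝ≥0∞) :
    ∫⁻ x, f x ∂S.toMeasure = ∑' x : S.points, f x := by
  rw [toMeasure, ← lintegral_indicator S.measurableSet_points, lintegral_count,
    tsum_subtype S.points f]

lemma measurable_toMeasure : Measurable (toMeasure : Config d → Measure (Space d)) := by
  refine Measure.measurable_of_measurable_coe _ fun B hB => ?_
  have h : ∀ S : Config d, S.toMeasure B = ⨆ n : ℕ, (S.count (B ∩ Metric.closedBall 0 n) : ℝ≥0∞) := by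
    intro S
    have hmono : Monotone fun n : ℕ => B ∩ Metric.closedBall (0 : Space d) n := fun m n hmn =>
      Set.inter_subset_inter_right _ (Metric.closedBall_subset_closedBall (by exact_mod_cast hmn))
    have hU : B = ⋃ n : ℕ, B ∩ Metric.closedBall (0 : Space d) n := by
      rw [← Set.inter_iUnion, Metric.iUnion_closedBall_nat, Set.inter_univ]
    conv_lhs => rw [hU, hmono.measure_iUnion]
    exact iSup_congr fun n => S.toMeasure_apply_of_isBounded (hB.inter measurableSet_closedBall)
      (Metric.isBounded_closedBall.subset Set.inter_subset_right)
  simp_rw [h]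
  refine Measurable.iSup fun n => ?_
  exact (Measurable.of_discrete (f := fun k : ℕ => (k : ℝ≥0∞))).comp (measurable_count
    (hB.inter measurableSet_closedBall) (Metric.isBounded_closedBall.subset Set.inter_subset_right))

/-- The kernel sending a configuration to the counting measure on its points. -/
def pointKernel (d : ℕ) : Kernel (Config d) (Space d) := ⟨toMeasure, measurable_toMeasure⟩

@[simp]
lemma pointKernel_apply (S : Config d) : pointKernel d S = S.toMeasure := rfl

/-- The shell of points whose norm has integer part `n`. -/
def shell (d n : ℕ) : Set (Space d) := {x | ⌊‖x‖⌋₊ = n}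

lemma measurableSet_shell (n : ℕ) : MeasurableSet (shell d n) :=
  (Nat.measurable_floor.comp measurable_norm) (measurableSet_singleton n)

lemma isBounded_shell (n : ℕ) : Bornology.IsBounded (shell d n) := by
  refine Metric.isBounded_closedBall (x := (0 : Space d)) (r := n + 1) |>.subset fun x hx => ?_
  have h := Nat.lt_floor_add_one ‖x‖
  simp only [shell, Set.mem_ofPred_eq] at hx
  rw [hx] at h
  simpa using h.le

open Classical in
instance : IsSFiniteKernel (pointKernel d) := by
  have hm (q : ℕ × ℕ) : MeasurableSet {S : Config d | S.count (shell d q.1) = q.2} :=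
    measurable_count (measurableSet_shell _) (isBounded_shell _) (measurableSet_singleton _)
  let κ (q : ℕ × ℕ) : Kernel (Config d) (Space d) :=
    Kernel.piecewise (hm q) ((pointKernel d).restrict (measurableSet_shell q.1)) 0
  have hfin (q : ℕ × ℕ) : IsFiniteKernel (κ q) := by
    refine ⟨q.2, ENNReal.natCast_lt_top _, fun S => ?_⟩
    rw [Kernel.piecewise_apply]
    split_ifs with h
    · rw [Kernel.restrict_apply, Measure.restrict_apply_univ, pointKernel_apply,
        S.toMeasure_apply_of_isBounded (measurableSet_shell _) (isBounded_shell _)]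
      exact_mod_cast le_of_eq h
    · simp
  have hsum : pointKernel d = Kernel.sum κ := by
    ext S B hB
    rw [Kernel.sum_apply' _ _ hB, ENNReal.tsum_prod']
    have h1 (n : ℕ) : ∑' k, κ (n, k) S B = S.toMeasure (B ∩ shell d n) := by
      rw [tsum_eq_single (S.count (shell d n))]
      · rw [Kernel.piecewise_apply, if_pos (by rfl), Kernel.restrict_apply, Measure.restrict_apply hB]
        rfl
      · intro k hk
        rw [Kernel.piecewise_apply, if_neg (fun h => hk h.symm)]
        simp
    simp_rw [h1]
    rw [← measure_iUnion]
    · rw [← Set.inter_iUnion]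
      have : ⋃ n, shell d n = Set.univ := by ext x; simp [shell]
      rw [this, Set.inter_univ]; rfl
    · intro m n hmn
      refine Set.disjoint_left.2 fun x hx hy => hmn ?_
      exact hx.2.symm.trans hy.2
    · exact fun n => hB.inter (measurableSet_shell n)
  rw [hsum]
  infer_instance

lemma measurable_lintegral_toMeasure {α : Type*} [MeasurableSpace α] {g : α → Config d}
    (hg : Measurable g) {f : α → Space d → ℝ≥0∞} (hf : Measurable (Function.uncurry f)) :
    Measurable fun a => ∫⁻ x, f a x ∂(g a).toMeasure :=
  Measurable.lintegral_kernel_prod_right' (κ := (pointKernel d).comap g hg) hf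

/-- The configuration with the point `x` added. -/
def insertPoint (x : Space d) (S : Config d) : Config d where
  points := insert x S.points
  finite_inter B hB := ((S.finite_inter B hB).insert x).subset fun y hy => by
    rcases hy.1 with h | h
    · exact Or.inl h
    · exact Or.inr ⟨h, hy.2⟩

@[simp]
lemma points_insertPoint (x : Space d) (S : Config d) :
    (insertPoint x S).points = insert x S.points := rfl

lemma lintegral_insertPoint {x : Space d} {S : Config d} (hx : x ∉ S.points) (f : Space d → ℝ≥0∞) :
    ∫⁻ y, f y ∂(insertPoint x S).toMeasure = f x + ∫⁻ y, f y ∂S.toMeasure := by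
  rw [toMeasure, points_insertPoint, Set.insert_eq, Measure.restrict_union
    (Set.disjoint_singleton_left.2 hx) S.measurableSet_points, lintegral_add_measure, toMeasure,
    Measure.restrict_singleton, Measure.count_singleton, one_smul, lintegral_dirac]

lemma measurable_count_section {α : Type*} [MeasurableSpace α] {g : α → Config d}
    (hg : Measurable g) {D : α → Set (Space d)}
    (hD : MeasurableSet {z : α × Space d | z.2 ∈ D z.1}) (hb : ∀ a, Bornology.IsBounded (D a)) :
    Measurable fun a => (g a).count (D a) := by
  have hDa (a : α) : MeasurableSet (D a) := measurable_prodMk_left hD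
  have h : ∀ a, ((g a).count (D a) : ℝ≥0∞) = ∫⁻ y, (D a).indicator 1 y ∂(g a).toMeasure := by
    intro a
    rw [lintegral_indicator_one (hDa a), toMeasure_apply_of_isBounded _ (hDa a) (hb a)]
  have hm : Measurable fun a => ((g a).count (D a) : ℝ≥0∞) := by
    simp_rw [h]
    exact measurable_lintegral_toMeasure hg
      (f := fun a y => (D a).indicator 1 y) (measurable_one.indicator hD)
  exact measurable_of_measurable_natCast hm

open Classical in
lemma count_insertPoint (x : Space d) (S : Config d) {B : Set (Space d)}
    (hb : Bornology.IsBounded B) :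
    (insertPoint x S).count B = S.count (B \ {x}) + if x ∈ B then 1 else 0 := by
  have hfin : (S.points ∩ (B \ {x})).Finite := S.finite_inter _ (hb.subset Set.sdiff_subset)
  unfold count
  split_ifs with h
  · have : (insertPoint x S).points ∩ B = insert x (S.points ∩ (B \ {x})) := by
      ext y
      by_cases hy : y = x <;> simp [hy, h]
    rw [this, Set.ncard_insert_of_notMem (by simp) hfin]
  · have : (insertPoint x S).points ∩ B = S.points ∩ (B \ {x}) := by
      ext y
      by_cases hy : y = x <;> simp [hy, h]
    rw [this, add_zero]

lemma count_diff_singleton {x : Space d} {S : Config d} (hx : x ∉ S.points) (B : Set (Space d)) :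
    S.count (B \ {x}) = S.count B := by
  unfold count
  congr 1
  ext y
  by_cases hy : y = x <;> simp [hy, hx]

lemma measurable_insertPoint :
    Measurable fun z : Space d × Config d => insertPoint z.1 z.2 := by
  classical
  refine measurable_of_count fun B hB hb => ?_
  simp_rw [count_insertPoint _ _ hb]
  refine Measurable.add ?_ ?_
  · refine measurable_count_section measurable_snd ?_ fun _ => hb.subset Set.sdiff_subset
    exact (measurable_snd hB).diff (measurableSet_eq_fun measurable_snd
      (measurable_fst.comp measurable_fst))
  · exact Measurable.ite (measurable_fst hB) measurable_const measurable_const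

lemma neighbours_eq_count (r : ℝ) (x : Space d) (S : Config d) :
    S.neighbours r x = S.count (Metric.closedBall x r \ {x}) := by
  rw [neighbours, count, Set.inter_sdiff_assoc]

lemma measurable_neighbours (r : ℝ) :
    Measurable fun z : Space d × Config d => z.2.neighbours r z.1 := by
  simp_rw [neighbours_eq_count]
  refine measurable_count_section measurable_snd ?_
    fun _ => Metric.isBounded_closedBall.subset Set.sdiff_subset
  refine MeasurableSet.diff ?_ (measurableSet_eq_fun measurable_snd
    (measurable_fst.comp measurable_fst))
  exact measurableSet_le (measurable_snd.dist (measurable_fst.comp measurable_fst))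
    measurable_const

end Config

end NeighbourThinning

namespace NeighbourThinning

lemma succ_mul_poissonMeasure_singleton (a : ℝ≥0) (n : ℕ) :
    ((n + 1 : ℕ) : ℝ≥0∞) * poissonMeasure a {n + 1} = a * poissonMeasure a {n} := by
  rw [poissonMeasure_singleton, poissonMeasure_singleton, ← ENNReal.ofReal_natCast,
    ← ENNReal.ofReal_coe_nnreal, ← ENNReal.ofReal_mul (by positivity),
    ← ENNReal.ofReal_mul (by positivity)]
  congr 1
  rw [Nat.factorial_succ]
  push_cast
  have : (n.factorial : ℝ) ≠ 0 := by positivity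
  field_simp
  ring

lemma lintegral_pi_poissonMeasure_mul {κ : Type*} [Fintype κ] [DecidableEq κ] (a : κ → ℝ≥0)
    (j : κ) (F : (κ → ℕ) → ℝ≥0∞) :
    ∫⁻ n, (n j : ℝ≥0∞) * F n ∂Measure.pi (fun i => poissonMeasure (a i)) =
      a j * ∫⁻ n, F (n + Pi.single j 1) ∂Measure.pi (fun i => poissonMeasure (a i)) := by
  rw [lintegral_countable', lintegral_countable', ← ENNReal.tsum_mul_left]
  have hinj : Function.Injective fun n : κ → ℕ => n + Pi.single j 1 := add_left_injective _
  rw [← hinj.tsum_eq]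
  · refine tsum_congr fun n => ?_
    rw [Measure.pi_singleton, Measure.pi_singleton, ← Finset.mul_prod_erase _ _ (Finset.mem_univ j),
      ← Finset.mul_prod_erase (a := j) _ _ (Finset.mem_univ j)]
    have h1 : ∏ i ∈ Finset.univ.erase j, poissonMeasure (a i) {n i + (Pi.single j 1 : κ → ℕ) i} =
        ∏ i ∈ Finset.univ.erase j, poissonMeasure (a i) {n i} := by
      refine Finset.prod_congr rfl fun i hi => ?_
      rw [Pi.single_eq_of_ne (Finset.ne_of_mem_erase hi), add_zero]
    have h2 := succ_mul_poissonMeasure_singleton (a j) (n j)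
    simp only [Pi.add_apply, Pi.single_eq_same, h1]
    calc _ = (((n j + 1 : ℕ) : ℝ≥0∞) * poissonMeasure (a j) {n j + 1}) *
          (F (n + Pi.single j 1) * ∏ i ∈ Finset.univ.erase j, poissonMeasure (a i) {n i}) := by ring
      _ = _ := by rw [h2]; ring
  · intro n hn
    have hj : n j ≠ 0 := by
      rintro h
      simp [h] at hn
    refine ⟨n - Pi.single j 1, ?_⟩
    ext i
    by_cases hi : i = j
    · subst hi; simp; omega
    · simp [hi]

namespace Config

variable {d : ℕ}

lemma count_biUnion (S : Config d) {κ : Type*} (s : Finset κ) {D : κ → Set (Space d)}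
    (hD : ∀ i ∈ s, MeasurableSet (D i)) (hb : ∀ i ∈ s, Bornology.IsBounded (D i))
    (hd : (s : Set κ).PairwiseDisjoint D) :
    S.count (⋃ i ∈ s, D i) = ∑ i ∈ s, S.count (D i) := by
  have h := measure_biUnion_finset (μ := S.toMeasure) hd hD
  rw [S.toMeasure_apply_of_isBounded (Finset.measurableSet_biUnion s hD)
    ((Bornology.isBounded_biUnion_finset s).2 hb),
    Finset.sum_congr rfl fun i hi => S.toMeasure_apply_of_isBounded (hD i hi) (hb i hi)] at h
  exact_mod_cast h

/-- Finite measures on configurations are determined by the joint laws of counts. -/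
lemma measure_ext_of_count {ν₁ ν₂ : Measure (Config d)} [IsFiniteMeasure ν₁]
    (h : ∀ s : Finset {B : Set (Space d) // MeasurableSet B ∧ Bornology.IsBounded B},
      ν₁.map (fun S (B : s) => S.count B.1.1) = ν₂.map (fun S (B : s) => S.count B.1.1)) :
    ν₁ = ν₂ := by
  let Φ (S : Config d) (B : {B : Set (Space d) // MeasurableSet B ∧ Bornology.IsBounded B}) : ℕ :=
    S.count B.1
  have hΦ : Measurable Φ := measurable_pi_iff.2 fun B => measurable_count B.2.1 B.2.2
  have hmap : ν₁.map Φ = ν₂.map Φ := by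
    refine IsProjectiveLimit.unique (P := fun s => (ν₁.map Φ).map s.restrict) (fun s => rfl)
      fun s => ?_
    simp only [Measure.map_map (Finset.measurable_restrict s) hΦ]
    exact (h s).symm
  ext E hE
  have hcomap : (instMeasurableSpace : MeasurableSpace (Config d)) ≤
      MeasurableSpace.comap Φ inferInstance := by
    refine iSup_le fun B => iSup_le fun hB => iSup_le fun hb => ?_
    have : (fun S : Config d => S.count B) = (fun n => n ⟨B, hB, hb⟩) ∘ Φ := rfl
    rw [this, ← MeasurableSpace.comap_comp]
    exact MeasurableSpace.comap_mono (measurable_pi_apply _).comap_le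
  obtain ⟨E', hE', rfl⟩ := hcomap E hE
  rw [← Measure.map_apply hΦ hE', ← Measure.map_apply hΦ hE', hmap]

end Config

section Partition

variable {α ι : Type*} (B : ι → Set α)

/-- The atom of the family `B` consisting of the points whose membership pattern is `J`. -/
def familyAtom (J : Finset ι) : Set α := {x | ∀ i, x ∈ B i ↔ i ∈ J}

lemma pairwise_disjoint_familyAtom : Pairwise fun J K => Disjoint (familyAtom B J) (familyAtom B K) := by
  intro J K hJK
  refine Set.disjoint_left.2 fun x hx hy => hJK ?_
  ext i
  exact (hx i).symm.trans (hy i)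

lemma eq_biUnion_familyAtom [Fintype ι] [DecidableEq ι] (i : ι) :
    B i = ⋃ J ∈ (Finset.univ.filter fun J : {J : Finset ι // J.Nonempty} => i ∈ J.1),
      familyAtom B J.1 := by
  classical
  ext x
  simp only [Set.mem_iUnion, Finset.mem_filter, Finset.mem_univ, true_and, exists_prop]
  constructor
  · intro hx
    refine ⟨⟨Finset.univ.filter fun i => x ∈ B i, ⟨i, by simpa using hx⟩⟩, by simpa using hx, ?_⟩
    intro k; simp
  · rintro ⟨J, hi, hx⟩
    exact (hx i).2 hi

lemma measurableSet_familyAtom [Countable ι] [MeasurableSpace α] (hB : ∀ i, MeasurableSet (B i))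
    (J : Finset ι) : MeasurableSet (familyAtom B J) := by
  have : familyAtom B J = ⋂ i, {x | x ∈ B i ↔ i ∈ J} := by
    ext x; simp [familyAtom]
  rw [this]
  refine MeasurableSet.iInter fun i => ?_
  by_cases h : i ∈ J
  · simpa [h] using hB i
  · convert (hB i).compl using 1
    ext x
    simp [h]

end Partition

variable {d : ℕ} {Ω : Type*} [MeasurableSpace Ω] {P : Measure Ω} {X : Ω → Config d} {lam : ℝ≥0}

namespace IsHomogeneousPoisson

lemma map_count [IsProbabilityMeasure P] (hX : IsHomogeneousPoisson P X lam) {κ : Type*} [Fintype κ]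
    {D : κ → Set (Space d)} (hD : ∀ i, MeasurableSet (D i))
    (hb : ∀ i, Bornology.IsBounded (D i)) (hd : Pairwise fun i j => Disjoint (D i) (D j)) :
    P.map (fun ω i => (X ω).count (D i)) =
      Measure.pi fun i => poissonMeasure (lam * (volume (D i)).toNNReal) := by
  let e := Fintype.equivFin κ
  have hi := hX.indep _ (fun k => D (e.symm k)) (fun _ => hD _) (fun _ => hb _)
    (fun i j hij => hd (e.symm.injective.ne hij))
  have hi' : iIndepFun (fun i ω => (X ω).count (D i)) P := by
    simpa using hi.precomp e.injective
  have hm (i : κ) : AEMeasurable (fun ω => (X ω).count (D i)) P :=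
    ((Config.measurable_count (hD i) (hb i)).comp hX.measurable).aemeasurable
  rw [(iIndepFun_iff_map_fun_eq_pi_map hm).1 hi']
  congr 1
  ext1 i
  exact (hX.law _ (hD i) (hb i)).map_eq

lemma ae_notMem [NeZero d] (hX : IsHomogeneousPoisson P X lam) (x : Space d) :
    ∀ᵐ ω ∂P, x ∉ (X ω).points := by
  have hl := hX.law {x} (measurableSet_singleton x) Bornology.isBounded_singleton
  have h0 : P ((fun ω => (X ω).count {x}) ⁻¹' {0}ᶜ) = 0 := by
    rw [← Measure.map_apply_of_aemeasurable hl.aemeasurable (MeasurableSet.of_discrete), hl.map_eq,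
      measure_compl (MeasurableSet.of_discrete) (measure_ne_top _ _)]
    simp [poissonMeasure_singleton]
  rw [ae_iff]
  refine measure_mono_null (fun ω hω => ?_) h0
  simp only [Set.mem_ofPred_eq, not_not] at hω
  simp [Config.count, hω]

lemma measurable_insertPoint_comp (hX : IsHomogeneousPoisson P X lam) :
    Measurable fun z : Space d × Ω => Config.insertPoint z.1 (X z.2) :=
  Config.measurable_insertPoint.comp (measurable_fst.prodMk (hX.measurable.comp measurable_snd))

variable [IsProbabilityMeasure P]

lemma lintegral_count_mul_of_disjoint [NeZero d] (hX : IsHomogeneousPoisson P X lam) {κ : Type*}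
    [Fintype κ] {D : κ → Set (Space d)} (hD : ∀ i, MeasurableSet (D i))
    (hb : ∀ i, Bornology.IsBounded (D i)) (hd : Pairwise fun i j => Disjoint (D i) (D j)) (j : κ)
    (F : (κ → ℕ) → ℝ≥0∞) :
    ∫⁻ ω, ((X ω).count (D j) : ℝ≥0∞) * F (fun i => (X ω).count (D i)) ∂P =
      lam * ∫⁻ x in D j, ∫⁻ ω, F (fun i => (Config.insertPoint x (X ω)).count (D i)) ∂P := by
  classical
  have hmeas : Measurable fun ω i => (X ω).count (D i) :=
    measurable_pi_iff.2 fun i => (Config.measurable_count (hD i) (hb i)).comp hX.measurable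
  have hinner : ∀ x ∈ D j, ∫⁻ ω, F (fun i => (Config.insertPoint x (X ω)).count (D i)) ∂P =
      ∫⁻ n, F (n + Pi.single j 1)
        ∂Measure.pi fun i => poissonMeasure (lam * (volume (D i)).toNNReal) := by
    intro x hx
    rw [← hX.map_count hD hb hd, lintegral_map Measurable.of_discrete hmeas]
    refine lintegral_congr_ae ?_
    filter_upwards [hX.ae_notMem x] with ω hω
    congr 1
    ext i
    rw [Config.count_insertPoint _ _ (hb i), Config.count_diff_singleton hω, Pi.add_apply,
      Pi.single_apply]
    congr 2
    refine propext ⟨fun h => ?_, fun h => h ▸ hx⟩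
    by_contra hij
    exact Set.disjoint_left.1 (hd hij) h hx
  rw [setLIntegral_congr_fun (hD j) hinner, setLIntegral_const,
    ← lintegral_map (f := fun n : κ → ℕ => (n j : ℝ≥0∞) * F n) Measurable.of_discrete hmeas,
    hX.map_count hD hb hd, lintegral_pi_poissonMeasure_mul, ENNReal.coe_mul,
    ENNReal.coe_toNNReal (hb j).measure_lt_top.ne]
  ring

lemma lintegral_count_mul [NeZero d] (hX : IsHomogeneousPoisson P X lam) {ι : Type*}
    [Fintype ι] {B : ι → Set (Space d)} (hB : ∀ i, MeasurableSet (B i))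
    (hb : ∀ i, Bornology.IsBounded (B i)) {A : Set (Space d)} (hA : MeasurableSet A)
    (hAb : Bornology.IsBounded A) (F : (ι → ℕ) → ℝ≥0∞) :
    ∫⁻ ω, ((X ω).count A : ℝ≥0∞) * F (fun i => (X ω).count (B i)) ∂P =
      lam * ∫⁻ x in A, ∫⁻ ω, F (fun i => (Config.insertPoint x (X ω)).count (B i)) ∂P := by
  classical
  let B' : Option ι → Set (Space d) := fun o => o.elim A B
  have hB' : ∀ o, MeasurableSet (B' o) := by rintro (_ | i); exacts [hA, hB i]
  have hb' : ∀ o, Bornology.IsBounded (B' o) := by rintro (_ | i); exacts [hAb, hb i]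
  let D : {J : Finset (Option ι) // J.Nonempty} → Set (Space d) := fun J => familyAtom B' J.1
  have hD : ∀ J, MeasurableSet (D J) := fun J => measurableSet_familyAtom B' hB' J.1
  have hDb : ∀ J, Bornology.IsBounded (D J) := by
    rintro ⟨J, i, hi⟩
    exact (hb' i).subset fun x hx => (hx i).2 hi
  have hDd : Pairwise fun J K => Disjoint (D J) (D K) := fun J K hJK =>
    pairwise_disjoint_familyAtom B' (Subtype.coe_injective.ne hJK)
  have hU : ∀ o, B' o = ⋃ J ∈ Finset.univ.filter (fun J : {J : Finset (Option ι) // J.Nonempty} =>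
      o ∈ J.1), D J := fun o => eq_biUnion_familyAtom B' o
  have hcount : ∀ (S : Config d) (o : Option ι), S.count (B' o) =
      ∑ J ∈ Finset.univ.filter (fun J : {J : Finset (Option ι) // J.Nonempty} => o ∈ J.1),
        S.count (D J) := by
    intro S o
    conv_lhs => rw [hU o]
    exact S.count_biUnion _ (fun J _ => hD J) (fun J _ => hDb J) fun J _ K _ h => hDd h
  let G : ({J : Finset (Option ι) // J.Nonempty} → ℕ) → ℝ≥0∞ := fun n => F fun i =>
    ∑ J ∈ Finset.univ.filter (fun J : {J : Finset (Option ι) // J.Nonempty} => some i ∈ J.1), n J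
  have hFG : ∀ S : Config d, F (fun i => S.count (B i)) = G fun J => S.count (D J) := fun S =>
    congrArg F (funext fun i => hcount S (some i))
  have hA' : A = _ := hU none
  have hcA : ∀ S : Config d, S.count A = _ := fun S => hcount S none
  simp_rw [hFG, hcA]
  push_cast
  simp_rw [Finset.sum_mul]
  rw [lintegral_finsetSum]
  · simp_rw [hX.lintegral_count_mul_of_disjoint hD hDb hDd]
    rw [← Finset.mul_sum, hA', lintegral_biUnion_finset]
    · exact fun J _ K _ h => hDd h
    · exact fun J _ => hD J
  · intro J _
    have hmeas : Measurable fun ω i => (X ω).count (D i) :=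
      measurable_pi_iff.2 fun i => (Config.measurable_count (hD i) (hDb i)).comp hX.measurable
    exact (Measurable.of_discrete (f := fun n : {J : Finset (Option ι) // J.Nonempty} → ℕ =>
      (n J : ℝ≥0∞) * G n)).comp hmeas

lemma withDensity_count_eq [NeZero d] (hX : IsHomogeneousPoisson P X lam)
    {A : Set (Space d)} (hA : MeasurableSet A) (hAb : Bornology.IsBounded A) :
    (P.map X).withDensity (fun S => (S.count A : ℝ≥0∞)) =
      (lam : ℝ≥0∞) • ((volume.restrict A).prod P).map
        (fun z => Config.insertPoint z.1 (X z.2)) := by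
  have hcA : Measurable fun S : Config d => (S.count A : ℝ≥0∞) :=
    (Measurable.of_discrete (f := fun k : ℕ => (k : ℝ≥0∞))).comp (Config.measurable_count hA hAb)
  have : IsFiniteMeasure ((P.map X).withDensity fun S => (S.count A : ℝ≥0∞)) := by
    refine ⟨?_⟩
    have h := hX.lintegral_count_mul (ι := Empty) (B := fun i => i.elim) (by simp) (by simp) hA hAb
      fun _ => 1
    rw [withDensity_apply _ MeasurableSet.univ, Measure.restrict_univ,
      lintegral_map hcA hX.measurable]
    simp only [mul_one, lintegral_const, measure_univ] at h
    rw [h]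
    exact ENNReal.mul_lt_top ENNReal.coe_lt_top (by simpa using hAb.measure_lt_top)
  refine Config.measure_ext_of_count fun s => ?_
  have hs : Measurable fun (S : Config d) (B : s) => S.count B.1.1 :=
    measurable_pi_iff.2 fun B => Config.measurable_count B.1.2.1 B.1.2.2
  ext E hE
  have h := hX.lintegral_count_mul (ι := s) (B := fun B => B.1.1) (fun B => B.1.2.1)
    (fun B => B.1.2.2) hA hAb (E.indicator 1)
  have hEm : Measurable (E.indicator (1 : (s → ℕ) → ℝ≥0∞)) := measurable_one.indicator hE
  have hEs : Measurable fun S : Config d => E.indicator (1 : (s → ℕ) → ℝ≥0∞)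
      (fun B => S.count B.1.1) := hEm.comp hs
  rw [← lintegral_indicator_one hE, ← lintegral_indicator_one hE, lintegral_map hEm hs,
    lintegral_map hEm hs, lintegral_withDensity_eq_lintegral_mul _ hcA hEs,
    lintegral_map (hcA.mul hEs) hX.measurable, lintegral_smul_measure,
    lintegral_map hEs hX.measurable_insertPoint_comp,
    lintegral_prod _ (by exact (hEs.comp hX.measurable_insertPoint_comp).aemeasurable)]
  exact h

/-- The Mecke formula for the homogeneous Poisson process. -/
theorem mecke [NeZero d] (hX : IsHomogeneousPoisson P X lam) {f : Space d → Config d → ℝ≥0∞}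
    (hf : Measurable (Function.uncurry f)) :
    ∫⁻ ω, ∫⁻ x, f x (X ω) ∂(X ω).toMeasure ∂P =
      lam * ∫⁻ x, ∫⁻ ω, f x (Config.insertPoint x (X ω)) ∂P := by
  have hins : Measurable fun z : Space d × Ω => (Config.insertPoint z.1 (X z.2), z.1) :=
    hX.measurable_insertPoint_comp.prodMk measurable_fst
  have hcampbell : (P.map X) ⊗ₘ Config.pointKernel d = (lam : ℝ≥0∞) •
      ((volume : Measure (Space d)).prod P).map
        (fun z => (Config.insertPoint z.1 (X z.2), z.1)) := by
    have := Measure.isProbabilityMeasure_map (μ := P) hX.measurable.aemeasurable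
    have hrect : ∀ (E : Set (Config d)) (A : Set (Space d)), MeasurableSet E → MeasurableSet A →
        Bornology.IsBounded A → ((P.map X) ⊗ₘ Config.pointKernel d) (E ×ˢ A) =
          ((lam : ℝ≥0∞) • ((volume : Measure (Space d)).prod P).map
            (fun z => (Config.insertPoint z.1 (X z.2), z.1))) (E ×ˢ A) := by
      intro E A hE hA hAb
      have h := congrArg (fun ν => ν E) (hX.withDensity_count_eq hA hAb)
      simp only [withDensity_apply _ hE, Measure.smul_apply,
        Measure.map_apply hX.measurable_insertPoint_comp hE] at h
      rw [Measure.compProd_apply_prod hE hA, Measure.smul_apply,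
        Measure.map_apply hins (hE.prod hA)]
      simp_rw [Config.pointKernel_apply, Config.toMeasure_apply_of_isBounded _ hA hAb]
      rw [h, Measure.restrict_prod_eq_prod_univ, Measure.restrict_apply
        (hX.measurable_insertPoint_comp hE)]
      congr 2
      ext z
      simp
    refine (Measure.ext_iff_of_iUnion_eq_univ (s := fun n : ℕ =>
      (Set.univ : Set (Config d)) ×ˢ Metric.closedBall (0 : Space d) n) ?_).2 fun n => ?_
    · rw [← Set.prod_iUnion, Metric.iUnion_closedBall_nat, Set.univ_prod_univ]
    have hfin : IsFiniteMeasure (((P.map X) ⊗ₘ Config.pointKernel d).restrict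
        (Set.univ ×ˢ Metric.closedBall (0 : Space d) n)) := by
      refine ⟨?_⟩
      rw [Measure.restrict_apply_univ, hrect _ _ .univ measurableSet_closedBall
        Metric.isBounded_closedBall, Measure.smul_apply,
        Measure.map_apply hins (MeasurableSet.univ.prod measurableSet_closedBall)]
      refine ENNReal.mul_lt_top ENNReal.coe_lt_top ?_
      refine (measure_mono (t := Metric.closedBall (0 : Space d) n ×ˢ Set.univ)
        fun z hz => ⟨hz.2, trivial⟩).trans_lt ?_
      rw [Measure.prod_prod, measure_univ, mul_one]
      exact Metric.isBounded_closedBall.measure_lt_top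
    refine Measure.ext_prod fun {E A} hE hA => ?_
    rw [Measure.restrict_apply (hE.prod hA), Measure.restrict_apply (hE.prod hA),
      Set.prod_inter_prod, Set.inter_univ]
    exact hrect _ _ hE (hA.inter measurableSet_closedBall)
      (Metric.isBounded_closedBall.subset Set.inter_subset_right)
  have hf' : Measurable fun z : Config d × Space d => f z.2 z.1 := hf.comp measurable_swap
  have := Measure.isProbabilityMeasure_map (μ := P) hX.measurable.aemeasurable
  have h := congrArg (fun ν => ∫⁻ z, f z.2 z.1 ∂ν) hcampbell
  simp only [lintegral_smul_measure] at h
  rw [Measure.lintegral_compProd hf', lintegral_map hf' hins,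
    lintegral_prod _ (by exact (hf'.comp hins).aemeasurable),
    lintegral_map _ hX.measurable] at h
  · exact h
  · exact hf'.lintegral_kernel_prod_right'

end IsHomogeneousPoisson

end NeighbourThinning

namespace NeighbourThinning

variable {d : ℕ}

/-- The second-order Mecke formula for the homogeneous Poisson process. -/
theorem IsHomogeneousPoisson.mecke_pair [NeZero d] {Ω : Type*} [MeasurableSpace Ω] {P : Measure Ω}
    [IsProbabilityMeasure P] {X : Ω → Config d} {lam : ℝ≥0} (hX : IsHomogeneousPoisson P X lam)
    {f : Space d → Space d → Config d → ℝ≥0∞}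
    (hf : Measurable fun z : (Space d × Config d) × Space d => f z.1.1 z.2 z.1.2) :
    ∫⁻ ω, ∫⁻ x, ∫⁻ y, ({x}ᶜ : Set (Space d)).indicator (fun y => f x y (X ω)) y
        ∂(X ω).toMeasure ∂(X ω).toMeasure ∂P =
      lam * ∫⁻ x, lam * ∫⁻ y, ∫⁻ ω,
        f x y (Config.insertPoint x (Config.insertPoint y (X ω))) ∂P := by
  have hne : MeasurableSet {z : (Space d × Config d) × Space d | z.2 ∈ ({z.1.1}ᶜ : Set (Space d))} :=
    (measurableSet_eq_fun measurable_snd (measurable_fst.comp measurable_fst)).compl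
  have hf' : Measurable fun z : (Space d × Config d) × Space d =>
      ({z.1.1}ᶜ : Set (Space d)).indicator (fun y => f z.1.1 y z.1.2) z.2 := hf.indicator hne
  rw [hX.mecke (f := fun x S => ∫⁻ y, ({x}ᶜ : Set (Space d)).indicator (fun y => f x y S) y
    ∂S.toMeasure) (Config.measurable_lintegral_toMeasure measurable_snd hf')]
  congr 1
  refine lintegral_congr fun x => ?_
  have h1 : ∀ᵐ ω ∂P, ∫⁻ y, ({x}ᶜ : Set (Space d)).indicator
      (fun y => f x y (Config.insertPoint x (X ω))) y ∂(Config.insertPoint x (X ω)).toMeasure =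
      ∫⁻ y, ({x}ᶜ : Set (Space d)).indicator
        (fun y => f x y (Config.insertPoint x (X ω))) y ∂(X ω).toMeasure := by
    filter_upwards [hX.ae_notMem x] with ω hω
    rw [Config.lintegral_insertPoint hω]
    simp
  rw [lintegral_congr_ae h1, hX.mecke (f := fun y S => ({x}ᶜ : Set (Space d)).indicator
    (fun y => f x y (Config.insertPoint x S)) y)]
  · congr 1
    refine lintegral_congr_ae ?_
    have h2 : ∀ᵐ y : Space d, y ∈ ({x}ᶜ : Set (Space d)) := by
      rw [ae_iff]
      simp
    filter_upwards [h2] with y hy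
    simp only [Set.indicator_of_mem hy]
  · have : Measurable fun z : Space d × Config d => ((x, Config.insertPoint x z.2), z.1) :=
      (measurable_const.prodMk (Config.measurable_insertPoint.comp
        (measurable_const.prodMk measurable_snd))).prodMk measurable_fst
    exact hf'.comp this

namespace Config

lemma encard_offDiag_inter (T : Config d) (C : Set (Space d × Space d)) :
    ((T.points.offDiag ∩ C).encard : ℝ≥0∞) =
      ∫⁻ x, ∫⁻ y, ({x}ᶜ : Set (Space d)).indicator (fun y => C.indicator 1 (x, y)) y
        ∂T.toMeasure ∂T.toMeasure := by
  simp_rw [lintegral_toMeasure]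
  rw [← ENNReal.tsum_set_one, tsum_subtype (T.points.offDiag ∩ C) (fun _ => (1 : ℝ≥0∞)),
    ENNReal.tsum_prod', tsum_subtype T.points fun x => ∑' y : T.points,
      ({x}ᶜ : Set (Space d)).indicator (fun y => C.indicator (1 : Space d × Space d → ℝ≥0∞) (x, y)) y]
  refine tsum_congr fun x => ?_
  by_cases hx : x ∈ T.points
  · rw [Set.indicator_of_mem hx, tsum_subtype T.points fun y => ({x}ᶜ : Set (Space d)).indicator
      (fun y => C.indicator (1 : Space d × Space d → ℝ≥0∞) (x, y)) y]
    refine tsum_congr fun y => ?_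
    by_cases hy : y ∈ T.points <;> by_cases hxy : y = x <;> by_cases hC : (x, y) ∈ C <;>
      simp [Set.indicator, hx, hy, hxy, hC, Ne.symm]
  · rw [Set.indicator_of_notMem hx]
    simp [Set.indicator, hx]

variable (r : ℝ) (p : ℕ → I) (S : Config d)

/-- The set of marks for which the point `x` is kept. -/
def keptMarks (x : S.points) : Set (S.points → I) := {u | u x ≤ p (S.neighbours r x)}

lemma measurableSet_keptMarks (x : S.points) : MeasurableSet (S.keptMarks r p x) :=
  measurableSet_le (measurable_pi_apply x) measurable_const

lemma lintegral_toMeasure_retain (u : S.points → I) (f : Space d → ℝ≥0∞) :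
    ∫⁻ x, f x ∂(S.retain r p u).toMeasure =
      ∑' x : S.points, (S.keptMarks r p x).indicator (fun _ => f x) u := by
  have h : (S.retain r p u).points = Subtype.val '' {x : S.points | u ∈ S.keptMarks r p x} := by
    ext x
    simp [retain, keptMarks]
  rw [lintegral_toMeasure, h, tsum_image f Subtype.val_injective.injOn,
    tsum_subtype {x : S.points | u ∈ S.keptMarks r p x} (fun x => f x)]
  rfl

lemma measurable_retain : Measurable (S.retain r p) := by
  refine measurable_of_count fun B hB hb => ?_
  have hm : Measurable fun u => ((S.retain r p u).count B : ℝ≥0∞) := by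
    simp_rw [← toMeasure_apply_of_isBounded _ hB hb, ← lintegral_indicator_one hB,
      lintegral_toMeasure_retain]
    exact Measurable.tsum fun x => measurable_const.indicator (S.measurableSet_keptMarks r p x)
  exact measurable_of_measurable_natCast hm

lemma infinitePi_biInter_keptMarks (s : Finset S.points) :
    Measure.infinitePi (fun _ : S.points => (volume : Measure I)) (⋂ x ∈ s, S.keptMarks r p x) =
      ∏ x ∈ s, ENNReal.ofReal (p (S.neighbours r x)) := by
  have h : ⋂ x ∈ s, S.keptMarks r p x =
      (s : Set S.points).pi fun x => Set.Iic (p (S.neighbours r x)) := by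
    ext u
    simp [keptMarks]
  rw [h, Measure.infinitePi_pi _ fun _ _ => measurableSet_Iic]
  simp only [unitInterval.volume_Iic]

lemma infinitePi_keptMarks (x : S.points) :
    Measure.infinitePi (fun _ : S.points => (volume : Measure I)) (S.keptMarks r p x) =
      ENNReal.ofReal (p (S.neighbours r x)) := by
  simpa using S.infinitePi_biInter_keptMarks r p {x}

lemma infinitePi_keptMarks_inter {x y : S.points} (hxy : x ≠ y) :
    Measure.infinitePi (fun _ : S.points => (volume : Measure I))
        (S.keptMarks r p x ∩ S.keptMarks r p y) =
      ENNReal.ofReal (p (S.neighbours r x)) * ENNReal.ofReal (p (S.neighbours r y)) := by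
  classical
  simpa [Finset.prod_pair hxy] using S.infinitePi_biInter_keptMarks r p {x, y}

lemma lintegral_thinnedLaw {f : Space d → ℝ≥0∞} (hf : Measurable f) :
    ∫⁻ T, ∫⁻ x, f x ∂T.toMeasure ∂(S.thinnedLaw r p) =
      ∫⁻ x, f x * ENNReal.ofReal (p (S.neighbours r x)) ∂S.toMeasure := by
  have hm : Measurable fun T : Config d => ∫⁻ x, f x ∂T.toMeasure :=
    measurable_lintegral_toMeasure measurable_id (f := fun _ x => f x) (hf.comp measurable_snd)
  rw [thinnedLaw, lintegral_map hm (S.measurable_retain r p)]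
  simp_rw [lintegral_toMeasure_retain]
  rw [lintegral_tsum fun x =>
    (measurable_const.indicator (S.measurableSet_keptMarks r p x)).aemeasurable,
    lintegral_toMeasure]
  refine tsum_congr fun x => ?_
  rw [lintegral_indicator_const (S.measurableSet_keptMarks r p x), infinitePi_keptMarks]

lemma lintegral_thinnedLaw_pair {f : Space d → Space d → ℝ≥0∞}
    (hf : Measurable (Function.uncurry f)) :
    ∫⁻ T, ∫⁻ x, ∫⁻ y, ({x}ᶜ : Set (Space d)).indicator (fun y => f x y) y
        ∂T.toMeasure ∂T.toMeasure ∂(S.thinnedLaw r p) =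
      ∫⁻ x, ∫⁻ y, ({x}ᶜ : Set (Space d)).indicator (fun y => f x y *
        (ENNReal.ofReal (p (S.neighbours r x)) * ENNReal.ofReal (p (S.neighbours r y)))) y
        ∂S.toMeasure ∂S.toMeasure := by
  have hm : Measurable fun z : (Config d × Space d) × Space d =>
      ({z.1.2}ᶜ : Set (Space d)).indicator (fun y => f z.1.2 y) z.2 :=
    (hf.comp ((measurable_snd.comp measurable_fst).prodMk measurable_snd)).indicator
      (measurableSet_eq_fun measurable_snd (measurable_snd.comp measurable_fst)).compl
  have hm' : Measurable fun T : Config d => ∫⁻ x, ∫⁻ y, ({x}ᶜ : Set (Space d)).indicator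
      (fun y => f x y) y ∂T.toMeasure ∂T.toMeasure :=
    measurable_lintegral_toMeasure measurable_id
      (measurable_lintegral_toMeasure measurable_fst hm)
  rw [thinnedLaw, lintegral_map hm' (S.measurable_retain r p)]
  simp_rw [lintegral_toMeasure_retain]
  have hm1 (x y : S.points) : Measurable ((S.keptMarks r p y).indicator fun _ =>
      ({x.1}ᶜ : Set (Space d)).indicator (fun y => f x y) y) :=
    measurable_const.indicator (S.measurableSet_keptMarks r p y)
  change ∫⁻ u, ∑' x : S.points, (S.keptMarks r p x).indicator (fun u => ∑' y : S.points,
    (S.keptMarks r p y).indicator (fun _ => ({x.1}ᶜ : Set (Space d)).indicator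
      (fun y => f x y) y) u) u ∂_ = _
  rw [lintegral_tsum fun x => ((Measurable.tsum fun y => hm1 x y).indicator
    (S.measurableSet_keptMarks r p x)).aemeasurable, lintegral_toMeasure]
  refine tsum_congr fun x => ?_
  rw [lintegral_indicator (S.measurableSet_keptMarks r p x),
    lintegral_tsum fun y => (hm1 x y).aemeasurable, lintegral_toMeasure]
  refine tsum_congr fun y => ?_
  rw [lintegral_indicator_const (S.measurableSet_keptMarks r p y),
    Measure.restrict_apply (S.measurableSet_keptMarks r p y), Set.inter_comm]
  by_cases hxy : x = y
  · simp [hxy]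
  · have : y.1 ∈ ({x.1}ᶜ : Set (Space d)) := fun h => hxy (Subtype.ext h.symm)
    rw [Set.indicator_of_mem this, Set.indicator_of_mem this, infinitePi_keptMarks_inter r p S hxy]

end Config

end NeighbourThinning

namespace NeighbourThinning

variable {d : ℕ}

lemma unitBallVolume_pos (d : ℕ) : 0 < unitBallVolume d :=
  ENNReal.toReal_pos (Metric.measure_closedBall_pos volume _ one_pos).ne'
    Metric.isBounded_closedBall.measure_lt_top.ne

lemma volume_real_closedBall (x : Space d) {r : ℝ} (hr : 0 < r) :
    volume.real (Metric.closedBall x r) = r ^ d * unitBallVolume d := by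
  rw [unitBallVolume, measureReal_def, measureReal_def, Measure.addHaar_closedBall' _ _ hr.le,
    ENNReal.toReal_mul, ENNReal.toReal_ofReal (by positivity), finrank_euclideanSpace_fin]

lemma volume_real_lens [NeZero d] (x y : Space d) {r : ℝ} (hr : 0 < r) :
    volume.real (Metric.closedBall x r ∩ Metric.closedBall y r) =
      r ^ d * unitBallVolume d * overlap d (‖x - y‖ / r) := by
  set t := ‖x - y‖ / r with ht
  set v : Space d := t • EuclideanSpace.single (0 : Fin d) (1 : ℝ) with hv
  set w : Space d := r⁻¹ • (y - x) with hw
  have ht0 : 0 ≤ t := by positivity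
  have hnorm : ‖v‖ = ‖w‖ := by
    rw [hv, hw, norm_smul, norm_smul, PiLp.norm_single, norm_sub_rev y x,
      Real.norm_of_nonneg ht0, norm_inv, Real.norm_of_nonneg hr.le, ht]
    simp [div_eq_inv_mul]
  let φ : Space d ≃ₗᵢ[ℝ] Space d := (ℝ ∙ (v - w))ᗮ.reflection
  have hφ : φ v = w := Submodule.reflection_sub hnorm
  have hpre : φ ⁻¹' ((fun z => r • z) ⁻¹' ((fun z => x + z) ⁻¹'
      (Metric.closedBall x r ∩ Metric.closedBall y r))) =
      Metric.closedBall 0 1 ∩ Metric.closedBall v 1 := by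
    ext z
    have h1 : dist (x + r • φ z) x = r * ‖z‖ := by
      rw [dist_eq_norm, add_sub_cancel_left, norm_smul, Real.norm_of_nonneg hr.le, φ.norm_map]
    have h2 : dist (x + r • φ z) y = r * ‖z - v‖ := by
      have : x + r • φ z - y = r • φ (z - v) := by
        rw [map_sub, hφ, hw, smul_sub, smul_smul, mul_inv_cancel₀ hr.ne', one_smul]
        abel
      rw [dist_eq_norm, this, norm_smul, Real.norm_of_nonneg hr.le, φ.norm_map]
    simp only [Set.mem_preimage, Set.mem_inter_iff, Metric.mem_closedBall, h1, h2, dist_eq_norm,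
      sub_zero, mul_le_iff_le_one_right hr]
  have hvol : volume.real (Metric.closedBall (0 : Space d) 1 ∩ Metric.closedBall v 1) =
      (r ^ d)⁻¹ * volume.real (Metric.closedBall x r ∩ Metric.closedBall y r) := by
    have hm : MeasurableSet ((fun z => r • z) ⁻¹' ((fun z => x + z) ⁻¹'
        (Metric.closedBall x r ∩ Metric.closedBall y r))) :=
      (measurable_const_smul r) ((measurable_const_add x)
        (measurableSet_closedBall.inter measurableSet_closedBall))
    rw [← hpre, measureReal_def, φ.measurePreserving.measure_preimage hm.nullMeasurableSet,
      Measure.addHaar_preimage_smul _ hr.ne', measure_preimage_add, ENNReal.toReal_mul,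
      ENNReal.toReal_ofReal (abs_nonneg _), finrank_euclideanSpace_fin,
      abs_of_nonneg (by positivity), measureReal_def]
  have hpos := unitBallVolume_pos d
  rw [overlap, hvol]
  field_simp

lemma overlap_eq_zero [NeZero d] {t : ℝ} (ht : 2 < t) : overlap d t = 0 := by
  rw [overlap, Set.disjoint_iff_inter_eq_empty.1, measureReal_empty, zero_div]
  refine Metric.closedBall_disjoint_closedBall ?_
  rw [dist_eq_norm, zero_sub, norm_neg, norm_smul, PiLp.norm_single,
    Real.norm_of_nonneg (by linarith)]
  simp
  linarith

lemma ofReal_meanRetention (p : ℕ → I) (a : ℝ≥0) :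
    ENNReal.ofReal (meanRetention p a) = ∫⁻ n, ENNReal.ofReal (p n) ∂(poissonMeasure a) := by
  refine ofReal_integral_eq_lintegral_ofReal ?_ (Filter.Eventually.of_forall fun n => (p n).2.1)
  exact Integrable.of_bound Measurable.of_discrete.aestronglyMeasurable 1
    (Filter.Eventually.of_forall fun n => by
      rw [Real.norm_of_nonneg (p n).2.1]; exact (p n).2.2)

lemma ofReal_jointRetention (p : ℕ → I) (a b : ℝ≥0) (i : ℕ) :
    ENNReal.ofReal (jointRetention p a b i) =
      ∫⁻ z : ℕ × ℕ × ℕ, ENNReal.ofReal (p (z.1 + z.2.1 + i)) * ENNReal.ofReal (p (z.1 + z.2.2 + i))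
        ∂((poissonMeasure a).prod ((poissonMeasure b).prod (poissonMeasure b))) := by
  have h0 (z : ℕ × ℕ × ℕ) : 0 ≤ (p (z.1 + z.2.1 + i) : ℝ) * (p (z.1 + z.2.2 + i) : ℝ) :=
    mul_nonneg (p _).2.1 (p _).2.1
  simp_rw [← ENNReal.ofReal_mul (p _).2.1]
  refine ofReal_integral_eq_lintegral_ofReal ?_ (Filter.Eventually.of_forall h0)
  exact Integrable.of_bound Measurable.of_discrete.aestronglyMeasurable 1
    (Filter.Eventually.of_forall fun z => by
      rw [Real.norm_of_nonneg (h0 z)]; exact mul_le_one₀ (p _).2.2 (p _).2.1 (p _).2.2)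

lemma meanRetention_pos {p : ℕ → I} (hp : ∃ n, p n ≠ 0) {a : ℝ≥0} (ha : 0 < a) :
    0 < meanRetention p a := by
  obtain ⟨n, hn⟩ := hp
  rw [← ENNReal.ofReal_pos, ofReal_meanRetention, lintegral_countable']
  refine lt_of_lt_of_le ?_ (ENNReal.le_tsum n)
  refine ENNReal.mul_pos ?_ ?_
  · rw [Ne, ENNReal.ofReal_eq_zero, not_le]
    exact unitInterval.pos_iff_ne_zero.2 hn
  · rw [poissonMeasure_singleton, Ne, ENNReal.ofReal_eq_zero, not_le]
    positivity

lemma jointRetention_zero_left (p : ℕ → I) (b : ℝ≥0) :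
    jointRetention p 0 b 0 = meanRetention p b ^ 2 := by
  have h0 : poissonMeasure 0 = Measure.dirac 0 := by
    refine Measure.ext_of_singleton fun n => ?_
    rw [poissonMeasure_singleton]
    rcases n with _ | n <;> simp
  rw [jointRetention, h0, Measure.dirac_prod, integral_map (by fun_prop)
    Measurable.of_discrete.aestronglyMeasurable]
  simp only [zero_add, add_zero]
  rw [integral_prod_mul (fun n : ℕ => (p n : ℝ)) (fun n : ℕ => (p n : ℝ)), meanRetention, sq]

lemma map_pi_fin_three (μ : Fin 3 → Measure ℕ) [∀ i, SigmaFinite (μ i)] :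
    (Measure.pi μ).map (fun n => (n 0, n 1, n 2)) = (μ 0).prod ((μ 1).prod (μ 2)) := by
  refine Measure.ext_of_singleton fun ⟨a, b, c⟩ => ?_
  have h : (fun n : Fin 3 → ℕ => (n 0, n 1, n 2)) ⁻¹' {(a, b, c)} = {![a, b, c]} := by
    ext n
    simp [funext_iff, Fin.forall_fin_succ]
  rw [Measure.map_apply Measurable.of_discrete (measurableSet_singleton _), h,
    Measure.pi_singleton, ← Set.singleton_prod_singleton, Measure.prod_prod,
    ← Set.singleton_prod_singleton, Measure.prod_prod, Fin.prod_univ_three, mul_assoc]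
  rfl

namespace Config

lemma insertPoint_comm (x y : Space d) (S : Config d) :
    insertPoint x (insertPoint y S) = insertPoint y (insertPoint x S) := by
  simp only [insertPoint, Set.insert_comm]

lemma neighbours_insertPoint_self {r : ℝ} {x : Space d} {S : Config d} (hx : x ∉ S.points) :
    (insertPoint x S).neighbours r x = S.count (Metric.closedBall x r) := by
  classical
  rw [neighbours_eq_count, count_insertPoint _ _ (Metric.isBounded_closedBall.subset
    Set.sdiff_subset), count_diff_singleton hx, count_diff_singleton hx]
  simp

lemma neighbours_insertPoint_pair {r : ℝ} {x y : Space d} {S : Config d} (hxy : x ≠ y)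
    (hx : x ∉ S.points) (hy : y ∉ S.points) :
    (insertPoint x (insertPoint y S)).neighbours r x =
      S.count (Metric.closedBall x r) + if ‖x - y‖ ≤ r then 1 else 0 := by
  classical
  rw [neighbours_insertPoint_self (by simp [hxy, hx]),
    count_insertPoint _ _ Metric.isBounded_closedBall, count_diff_singleton hy]
  rw [mem_closedBall_iff_norm']

lemma count_inter_add_sdiff (S : Config d) {A B : Set (Space d)} (hA : Bornology.IsBounded A) :
    S.count (A ∩ B) + S.count (A \ B) = S.count A := by
  have h := Set.ncard_inter_add_ncard_sdiff_eq_ncard (S.points ∩ A) B (S.finite_inter A hA)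
  rwa [Set.inter_assoc, Set.inter_sdiff_assoc] at h

end Config

namespace IsHomogeneousPoisson

variable {Ω : Type*} [MeasurableSpace Ω] {P : Measure Ω}
  {X : Ω → Config d} {lam : ℝ≥0} [NeZero d] {r μ : ℝ}

lemma lintegral_neighbours (hX : IsHomogeneousPoisson P X lam) (hr : 0 < r)
    (hμ : μ = lam * unitBallVolume d * r ^ d) (p : ℕ → I) (x : Space d) :
    ∫⁻ ω, ENNReal.ofReal (p ((Config.insertPoint x (X ω)).neighbours r x)) ∂P =
      ENNReal.ofReal (meanRetention p μ.toNNReal) := by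
  have hl := hX.law (Metric.closedBall x r) measurableSet_closedBall Metric.isBounded_closedBall
  have ha : lam * (volume (Metric.closedBall x r)).toNNReal = μ.toNNReal := by
    refine NNReal.eq ?_
    have h := volume_real_closedBall x hr
    have := unitBallVolume_pos d
    rw [Real.coe_toNNReal _ (hμ ▸ by positivity), NNReal.coe_mul, hμ, mul_assoc, mul_comm _ (r ^ d),
      ← h]
    rfl
  rw [ofReal_meanRetention, ← ha, ← hl.map_eq, lintegral_map' (by fun_prop) hl.aemeasurable]
  refine lintegral_congr_ae ?_
  filter_upwards [hX.ae_notMem x] with ω hω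
  rw [Config.neighbours_insertPoint_self hω]

lemma lintegral_neighbours_pair [IsProbabilityMeasure P] (hX : IsHomogeneousPoisson P X lam) (hr : 0 < r)
    (hμ : μ = lam * unitBallVolume d * r ^ d) (p : ℕ → I) {x y : Space d} (hxy : x ≠ y) :
    ∫⁻ ω, ENNReal.ofReal
        (p ((Config.insertPoint x (Config.insertPoint y (X ω))).neighbours r x)) *
      ENNReal.ofReal (p ((Config.insertPoint x (Config.insertPoint y (X ω))).neighbours r y)) ∂P =
      ENNReal.ofReal (jointRetention p (μ * overlap d (‖x - y‖ / r)).toNNReal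
        (μ * (1 - overlap d (‖x - y‖ / r))).toNNReal (if ‖x - y‖ ≤ r then 1 else 0)) := by
  set Bx := Metric.closedBall x r with hBx
  set By := Metric.closedBall y r with hBy
  have hxm : MeasurableSet Bx := measurableSet_closedBall
  have hym : MeasurableSet By := measurableSet_closedBall
  have hxb : Bornology.IsBounded Bx := Metric.isBounded_closedBall
  have hyb : Bornology.IsBounded By := Metric.isBounded_closedBall
  let D : Fin 3 → Set (Space d) := ![Bx ∩ By, Bx \ By, By \ Bx]
  have hD : ∀ i, MeasurableSet (D i) := by
    simp only [Fin.forall_fin_succ, D]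
    exact ⟨hxm.inter hym, hxm.diff hym, hym.diff hxm, by simp⟩
  have hDb : ∀ i, Bornology.IsBounded (D i) := by
    simp only [Fin.forall_fin_succ, D]
    exact ⟨hxb.subset Set.inter_subset_left, hxb.subset Set.sdiff_subset,
      hyb.subset Set.sdiff_subset, by simp⟩
  have hDd : Pairwise fun i j => Disjoint (D i) (D j) := by
    intro i j hij
    refine Set.disjoint_left.2 fun z hi hj => hij ?_
    fin_cases i <;> fin_cases j <;> first | rfl | (exfalso; simp [D] at hi hj; grind)
  have hlens := volume_real_lens x y hr
  have hsdiff : ∀ u v : Space d, volume.real (Metric.closedBall u r \ Metric.closedBall v r) =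
      r ^ d * unitBallVolume d * (1 - overlap d (‖u - v‖ / r)) := by
    intro u v
    have h := measureReal_inter_add_sdiff (μ := volume) (s := Metric.closedBall u r)
      (t := Metric.closedBall v r) measurableSet_closedBall
      Metric.isBounded_closedBall.measure_lt_top.ne
    rw [volume_real_lens u v hr, volume_real_closedBall u hr] at h
    linarith
  have h0 : lam * (volume (D 0)).toNNReal = (μ * overlap d (‖x - y‖ / r)).toNNReal := by
    have : μ * overlap d (‖x - y‖ / r) = lam * volume.real (Bx ∩ By) := by
      rw [hμ, hlens]; ring
    rw [this]
    refine NNReal.eq ?_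
    rw [Real.coe_toNNReal _ (by positivity)]
    rfl
  have h1 : lam * (volume (D 1)).toNNReal = (μ * (1 - overlap d (‖x - y‖ / r))).toNNReal := by
    have : μ * (1 - overlap d (‖x - y‖ / r)) = lam * volume.real (Bx \ By) := by
      rw [hμ, hsdiff]; ring
    rw [this]
    refine NNReal.eq ?_
    rw [Real.coe_toNNReal _ (by positivity)]
    rfl
  have h2 : lam * (volume (D 2)).toNNReal = (μ * (1 - overlap d (‖x - y‖ / r))).toNNReal := by
    have : μ * (1 - overlap d (‖x - y‖ / r)) = lam * volume.real (By \ Bx) := by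
      rw [hμ, hsdiff, norm_sub_rev y x]; ring
    rw [this]
    refine NNReal.eq ?_
    rw [Real.coe_toNNReal _ (by positivity)]
    rfl
  have hmeas : Measurable fun ω i => (X ω).count (D i) :=
    measurable_pi_iff.2 fun i => (Config.measurable_count (hD i) (hDb i)).comp hX.measurable
  have hmap : P.map (fun ω => ((X ω).count (D 0), (X ω).count (D 1), (X ω).count (D 2))) =
      (poissonMeasure (μ * overlap d (‖x - y‖ / r)).toNNReal).prod
        ((poissonMeasure (μ * (1 - overlap d (‖x - y‖ / r))).toNNReal).prod
          (poissonMeasure (μ * (1 - overlap d (‖x - y‖ / r))).toNNReal)) := by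
    rw [← h0]
    nth_rw 1 [← h1]
    rw [← h2, ← map_pi_fin_three fun i => poissonMeasure (lam * (volume (D i)).toNNReal),
      ← hX.map_count hD hDb hDd, Measure.map_map Measurable.of_discrete hmeas]
    rfl
  have hmeas' : Measurable fun ω => ((X ω).count (D 0), (X ω).count (D 1), (X ω).count (D 2)) :=
    (Measurable.of_discrete (f := fun n : Fin 3 → ℕ => (n 0, n 1, n 2))).comp hmeas
  rw [ofReal_jointRetention, ← hmap, lintegral_map Measurable.of_discrete hmeas']
  refine lintegral_congr_ae ?_
  filter_upwards [hX.ae_notMem x, hX.ae_notMem y] with ω hx hy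
  have ex := (X ω).count_inter_add_sdiff (B := By) hxb
  have ey := (X ω).count_inter_add_sdiff (B := Bx) hyb
  rw [Set.inter_comm] at ey
  rw [Config.neighbours_insertPoint_pair hxy hx hy, Config.insertPoint_comm,
    Config.neighbours_insertPoint_pair hxy.symm hy hx, norm_sub_rev y x, ← hBx, ← hBy, ← ex, ← ey]
  rfl

end IsHomogeneousPoisson

end NeighbourThinning

namespace NeighbourThinning

lemma measurable_ofReal_retention {d : ℕ} {α : Type*} [MeasurableSpace α] (r : ℝ) (p : ℕ → I)
    {g : α → Space d} {S : α → Config d} (hg : Measurable g) (hS : Measurable S) :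
    Measurable fun a => ENNReal.ofReal (p ((S a).neighbours r (g a))) := by
  have hp : Measurable fun n : ℕ => ENNReal.ofReal (p n) := Measurable.of_discrete
  have hn := hp.comp ((Config.measurable_neighbours (d := d) r).comp (hg.prodMk hS))
  simp only [Function.comp_def] at hn
  exact hn

lemma IsPairCorrelation.ae_eq {d : ℕ} {Ω : Type*} [MeasurableSpace Ω] {P : Measure Ω}
    {Y : Ω → Config d} {g g' : Space d → Space d → ℝ}
    (hg : IsPairCorrelation P Y g)
    (hg' : IsPairCorrelation P Y g') :
    ∀ᵐ z ∂((volume : Measure (Space d)).prod volume), g' z.1 z.2 = g z.1 z.2 := by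
  obtain ⟨ρ, ρ₂, hρ, hρ₂, h⟩ := hg
  obtain ⟨ρ', ρ₂', hρ', hρ₂', h'⟩ := hg'
  have h1 : (fun x => (ρ' x : ℝ≥0∞)) =ᵐ[volume] fun x => (ρ x : ℝ≥0∞) :=
    ae_eq_of_forall_setLIntegral_eq_of_sigmaFinite hρ'.1.coe_nnreal_ennreal
      hρ.1.coe_nnreal_ennreal fun s hs _ => (hρ'.2 s hs).symm.trans (hρ.2 s hs)
  have h2 : (fun z => (ρ₂' z : ℝ≥0∞)) =ᵐ[(volume : Measure (Space d)).prod volume]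
      fun z => (ρ₂ z : ℝ≥0∞) :=
    ae_eq_of_forall_setLIntegral_eq_of_sigmaFinite hρ₂'.1.coe_nnreal_ennreal
      hρ₂.1.coe_nnreal_ennreal fun s hs _ => (hρ₂'.2 s hs).symm.trans (hρ₂.2 s hs)
  filter_upwards [h2, Measure.quasiMeasurePreserving_fst.ae h1,
    Measure.quasiMeasurePreserving_snd.ae h1] with z e2 e e'
  rw [h, h', ENNReal.coe_injective e2, ENNReal.coe_injective e, ENNReal.coe_injective e']

variable {d : ℕ} [NeZero d] {Ω : Type*} [MeasurableSpace Ω] {P : Measure Ω}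
  [IsProbabilityMeasure P] {lam : ℝ≥0} {r μ : ℝ} {p : ℕ → I} {X Y : Ω → Config d}

lemma isIntensity_thinning (hr : 0 < r) (hX : IsHomogeneousPoisson P X lam)
    (hY : IsThinning P r p X Y) (hμ : μ = lam * unitBallVolume d * r ^ d) :
    IsIntensity P Y fun _ => lam * (meanRetention p μ.toNNReal).toNNReal := by
  refine ⟨measurable_const, fun B hB => ?_⟩
  have hind : Measurable (B.indicator (1 : Space d → ℝ≥0∞)) := measurable_one.indicator hB
  have hF : Measurable fun z : Config d × Config d => ∫⁻ x, B.indicator 1 x ∂z.2.toMeasure :=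
    Config.measurable_lintegral_toMeasure measurable_snd (f := fun _ x => B.indicator 1 x)
      (hind.comp measurable_snd)
  simp_rw [← Config.toMeasure_apply _ hB, ← lintegral_indicator_one hB]
  rw [hY.disintegration _ hF]
  simp_rw [Config.lintegral_thinnedLaw r p _ hind]
  rw [hX.mecke (f := fun x S => B.indicator 1 x * ENNReal.ofReal (p (S.neighbours r x)))
    ((hind.comp measurable_fst).mul (measurable_ofReal_retention r p measurable_fst
      measurable_snd))]
  have hinner (x : Space d) : ∫⁻ ω, B.indicator 1 x *
      ENNReal.ofReal (p ((Config.insertPoint x (X ω)).neighbours r x)) ∂P =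
      B.indicator (fun _ => ENNReal.ofReal (meanRetention p μ.toNNReal)) x := by
    rw [lintegral_const_mul, hX.lintegral_neighbours hr hμ]
    · by_cases hx : x ∈ B <;> simp [hx]
    · exact measurable_ofReal_retention r p measurable_const
        (hX.measurable_insertPoint_comp.comp (measurable_const.prodMk measurable_id))
  simp_rw [hinner]
  rw [lintegral_indicator_const hB, setLIntegral_const, ENNReal.coe_mul, mul_assoc]
  rfl

/-- `E[p(U + V₁ + i) p(U + V₂ + i)]` for two points at distance `s`. -/
def pairRetention (d : ℕ) [NeZero d] (p : ℕ → I) (μ r s : ℝ) : ℝ :=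
  jointRetention p (μ * overlap d (s / r)).toNNReal (μ * (1 - overlap d (s / r))).toNNReal
    (if s ≤ r then 1 else 0)

lemma pairRetention_nonneg (p : ℕ → I) (μ r s : ℝ) : 0 ≤ pairRetention d p μ r s :=
  integral_nonneg fun _ => mul_nonneg (p _).2.1 (p _).2.1

lemma isProductDensity₂_thinning (hr : 0 < r) (hX : IsHomogeneousPoisson P X lam)
    (hY : IsThinning P r p X Y) (hμ : μ = lam * unitBallVolume d * r ^ d) :
    IsProductDensity₂ P Y fun z => lam * (lam * (pairRetention d p μ r ‖z.1 - z.2‖).toNNReal) := by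
  classical
  let G (x y : Space d) : ℝ≥0∞ := ∫⁻ ω, ENNReal.ofReal
      (p ((Config.insertPoint x (Config.insertPoint y (X ω))).neighbours r x)) *
    ENNReal.ofReal (p ((Config.insertPoint x (Config.insertPoint y (X ω))).neighbours r y)) ∂P
  have hS : Measurable fun q : (Space d × Space d) × Ω =>
      Config.insertPoint q.1.1 (Config.insertPoint q.1.2 (X q.2)) :=
    Config.measurable_insertPoint.comp ((measurable_fst.comp measurable_fst).prodMk
      (hX.measurable_insertPoint_comp.comp
        ((measurable_snd.comp measurable_fst).prodMk measurable_snd)))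
  have hprod : Measurable fun q : (Space d × Space d) × Ω =>
      ENNReal.ofReal (p ((Config.insertPoint q.1.1
        (Config.insertPoint q.1.2 (X q.2))).neighbours r q.1.1)) *
      ENNReal.ofReal (p ((Config.insertPoint q.1.1
        (Config.insertPoint q.1.2 (X q.2))).neighbours r q.1.2)) :=
    (measurable_ofReal_retention r p (measurable_fst.comp measurable_fst) hS).mul
      (measurable_ofReal_retention r p (measurable_snd.comp measurable_fst) hS)
  have hG : Measurable fun z : Space d × Space d => G z.1 z.2 := hprod.lintegral_prod_right'
  have hGJ {x y : Space d} (hxy : x ≠ y) :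
      G x y = ENNReal.ofReal (pairRetention d p μ r ‖x - y‖) :=
    hX.lintegral_neighbours_pair hr hμ p hxy
  have hJ : Measurable fun z : Space d × Space d =>
      (pairRetention d p μ r ‖z.1 - z.2‖).toNNReal := by
    have h : ∀ z : Space d × Space d, (pairRetention d p μ r ‖z.1 - z.2‖).toNNReal =
        if z.1 = z.2 then (pairRetention d p μ r 0).toNNReal else (G z.1 z.2).toNNReal := by
      intro z
      split_ifs with hz
      · simp [hz]
      · rw [hGJ hz]; rfl
    simp_rw [h]
    exact Measurable.ite (measurableSet_eq_fun measurable_fst measurable_snd) measurable_const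
      hG.ennreal_toNNReal
  refine ⟨(hJ.const_mul _).const_mul _, fun C hC => ?_⟩
  have hind : Measurable (C.indicator (1 : Space d × Space d → ℝ≥0∞)) :=
    measurable_one.indicator hC
  have hF : Measurable fun z : Config d × Config d => ∫⁻ x, ∫⁻ y, ({x}ᶜ : Set (Space d)).indicator
      (fun y => C.indicator 1 (x, y)) y ∂z.2.toMeasure ∂z.2.toMeasure := by
    refine Config.measurable_lintegral_toMeasure measurable_snd
      (Config.measurable_lintegral_toMeasure (measurable_snd.comp measurable_fst) ?_)
    exact (hind.comp ((measurable_snd.comp measurable_fst).prodMk measurable_snd)).indicator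
      (measurableSet_eq_fun measurable_snd (measurable_snd.comp measurable_fst)).compl
  simp_rw [Config.encard_offDiag_inter]
  rw [hY.disintegration _ hF]
  simp_rw [Config.lintegral_thinnedLaw_pair r p _ (f := fun x y => C.indicator 1 (x, y)) hind]
  rw [hX.mecke_pair (f := fun x y S => C.indicator 1 (x, y) *
    (ENNReal.ofReal (p (S.neighbours r x)) * ENNReal.ofReal (p (S.neighbours r y))))
    ((hind.comp ((measurable_fst.comp measurable_fst).prodMk measurable_snd)).mul
      ((measurable_ofReal_retention r p (measurable_fst.comp measurable_fst)
        (measurable_snd.comp measurable_fst)).mul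
      (measurable_ofReal_retention r p measurable_snd (measurable_snd.comp measurable_fst))))]
  have hinner (x : Space d) : ∫⁻ y, ∫⁻ ω, C.indicator 1 (x, y) * (ENNReal.ofReal
        (p ((Config.insertPoint x (Config.insertPoint y (X ω))).neighbours r x)) *
      ENNReal.ofReal (p ((Config.insertPoint x (Config.insertPoint y (X ω))).neighbours r y))) ∂P =
      ∫⁻ y, C.indicator (fun z => ENNReal.ofReal (pairRetention d p μ r ‖z.1 - z.2‖)) (x, y) := by
    refine lintegral_congr_ae ?_
    have hne : ∀ᵐ y : Space d, y ≠ x := by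
      rw [ae_iff]
      simp
    filter_upwards [hne] with y hy
    have hω := hprod.comp (measurable_prodMk_left (x := (x, y)))
    simp only [Function.comp_def] at hω
    rw [lintegral_const_mul _ hω]
    change _ * G x y = _
    rw [hGJ hy.symm]
    by_cases hxy : (x, y) ∈ C <;> simp [hxy]
  have hJC : Measurable (C.indicator fun z : Space d × Space d =>
      ENNReal.ofReal (pairRetention d p μ r ‖z.1 - z.2‖)) :=
    (hJ.coe_nnreal_ennreal).indicator hC
  simp_rw [hinner]
  rw [lintegral_const_mul _ hJC.lintegral_prod_right', ← lintegral_prod _ hJC.aemeasurable,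
    lintegral_indicator hC]
  simp_rw [ENNReal.coe_mul]
  rw [lintegral_const_mul _ (hJ.coe_nnreal_ennreal.const_mul _),
    lintegral_const_mul _ hJ.coe_nnreal_ennreal]
  rfl

end NeighbourThinning

end

theorem mainTheorem1 {d : ℕ} [NeZero d] {Ω : Type*} [MeasurableSpace Ω]
    (P : Measure Ω) [IsProbabilityMeasure P]
    (lam : ℝ≥0) (hlam : 0 < lam) (r : ℝ) (hr : 0 < r)
    (p : ℕ → unitInterval) (hp : ∃ n, p n ≠ 0)
    (X Y : Ω → Config d)
    (hX : IsHomogeneousPoisson P X lam) (hY : IsThinning P r p X Y)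
    (μ : ℝ) (hμ : μ = lam * unitBallVolume d * r ^ d) :
    ∃ g : ℝ → ℝ,
      IsRadialPairCorrelation P Y g ∧
      (∀ g' : Space d → Space d → ℝ, IsPairCorrelation P Y g' →
        ∀ᵐ z ∂((volume : Measure (Space d)).prod volume), g' z.1 z.2 = g ‖z.1 - z.2‖) ∧
      (∀ h : Space d,
        g ‖h‖ =
          jointRetention p (μ * overlap d (‖h‖ / r)).toNNReal
              (μ * (1 - overlap d (‖h‖ / r))).toNNReal (if ‖h‖ ≤ r then 1 else 0) /
            meanRetention p μ.toNNReal ^ 2) ∧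
      (∀ h : Space d, 2 * r < ‖h‖ → g ‖h‖ = 1) := by
  have hμ0 : 0 < μ := by
    have := unitBallVolume_pos d
    have : (0 : ℝ) < lam := hlam
    rw [hμ]
    positivity
  have hmean : 0 < meanRetention p μ.toNNReal := meanRetention_pos hp (Real.toNNReal_pos.2 hμ0)
  have hg : IsRadialPairCorrelation P Y fun s =>
      pairRetention d p μ r s / meanRetention p μ.toNNReal ^ 2 := by
    refine ⟨_, _, isIntensity_thinning hr hX hY hμ, isProductDensity₂_thinning hr hX hY hμ,
      fun x y => ?_⟩
    have hlam' : (lam : ℝ) ≠ 0 := by exact_mod_cast hlam.ne'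
    simp only [NNReal.coe_mul, Real.coe_toNNReal _ (pairRetention_nonneg (d := d) p μ r _),
      Real.coe_toNNReal _ hmean.le]
    field_simp
  refine ⟨_, hg, fun g' hg' => hg.ae_eq hg', fun h => rfl, fun h hh => ?_⟩
  have h2 : 2 < ‖h‖ / r := by rwa [lt_div_iff₀ hr]
  have hrh : ¬ ‖h‖ ≤ r := by linarith
  simp only [pairRetention, overlap_eq_zero h2, if_neg hrh, mul_zero, sub_zero, mul_one,
    Real.toNNReal_zero, jointRetention_zero_left]
  exact div_self (pow_pos hmean 2).ne'
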